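/- Let $(A,\mathfrak{m})$ be a Noetherian local (commutative) ring, and let $y \in \mathfrak{m}$ be a nonzerodivisor. (i) If $A/yA$ is normal, then $A$ is normal. (ii) If $A/yA$ is weakly normal, then $A$ is weakly normal. Here a commutative ring $R$ is called normal if it is reduced and integrally closed in its total quotient ring $Q(R)$. It is called seminormal if for all $b,c \in R$ with $b^3=c^2$ there exists $a \in R$ with $a^2=b$ and $a^3=c$. It is called weakly normal if it is seminormal and, for every prime number $p$, all $b,c,e \in R$ and every nonzerodivisor $d \in R$ such that $c^p=bd^p$ and $pc=de$, there exists $a \in R$ with $b=a^p$ and $e=pa$. -/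

import Mathlib

universe u

/-- A commutative ring is normal if it is reduced and integrally closed in its total ring of
fractions `Q(A)` (`FractionRing A` is the localization of `A` at all its nonzerodivisors).
For Noetherian rings this says that all localizations at primes are integrally closed domains. -/
def IsNormalRing (A : Type u) [CommRing A] : Prop :=
  IsReduced A ∧ IsIntegrallyClosedIn A (FractionRing A)

/-- A commutative ring `A` is seminormal (in the sense of Swan) if for all `b, c ∈ A` with
`b ^ 3 = c ^ 2` there is an `a ∈ A` with `a ^ 2 = b` and `a ^ 3 = c`. -/
def IsSeminormalRing (A : Type u) [CommRing A] : Prop :=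
  ∀ b c : A, b ^ 3 = c ^ 2 → ∃ a : A, a ^ 2 = b ∧ a ^ 3 = c

/-- A commutative ring `A` is weakly normal (in the sense of Yanagihara) if it is seminormal and,
for all `b, c, e ∈ A`, all nonzerodivisors `d ∈ A` and all prime numbers `p` with
`c ^ p = b * d ^ p` and `p * c = d * e`, there is an `a ∈ A` with `b = a ^ p` and `e = p * a`. -/
def IsWeaklyNormalRing (A : Type u) [CommRing A] : Prop :=
  IsSeminormalRing A ∧
    ∀ b c e d : A, d ∈ nonZeroDivisors A → ∀ p : ℕ, p.Prime →
      c ^ p = b * d ^ p → (p : A) * c = d * e → ∃ a : A, b = a ^ p ∧ e = (p : A) * a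

open Polynomial nonZeroDivisors

/-! Suppose x in K = Q(A), outside A, witnesses a failure for A. The relations on x pass to its
multiples, and an associated prime of (Ax + A)/A lets one assume that P = (A : x) is prime. Let M =
(P : P) in K (`multiplierRing`), which is finite over A and contains x. Since A/yA is reduced, y is
not in P and P contains some d regular modulo y. Then z ↦ (dz mod y)/(d mod y) embeds M/yM into
Q(A/yA), and an element with image in A/yA lies in A + yM (`exists_eq_add_smul`).

Normality: images of M are integral, hence in A/yA, so M = A + yM and Nakayama puts x in A, against
P being proper. The condition at p: the same with N = {w in M : w^p in A}, which is additive because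
p lies in P.

Seminormality: elements of M with square in A need not form a module. Take instead N, the elements
of M that a power of y moves into Ax + P. Their squares lie in P and their cubes in A, so reduction
modulo y embeds (N/P)/y(N/P) into A/(P + yA). At a prime Q minimal over P + yA both sides have the
same finite length (`localLength_quotient_range_lsmul`), yet the image lies in Q/(P + yA), since its
elements have square zero. This is the contradiction. -/

/-! ### Reduced rings -/

theorem isReduced_of_isReduced_quotient {A : Type*} [CommRing A] [IsNoetherianRing A]
    {y : A} (hyj : y ∈ Ideal.jacobson (⊥ : Ideal A)) (hy : y ∈ A⁰)
    (h : IsReduced (A ⧸ Ideal.span {y})) : IsReduced A := by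
  refine (isReduced_iff_pow_one_lt 2 one_lt_two).mpr fun n hn => ?_
  have key : ∀ n : A, n ^ 2 = 0 → ∃ m : A, m ^ 2 = 0 ∧ n = y * m := by
    intro n hn
    have h0 : (Ideal.Quotient.mk (Ideal.span {y}) n) ^ 2 = 0 := by
      rw [← map_pow, hn, map_zero]
    have h1 := pow_eq_zero_iff (two_ne_zero) |>.mp h0
    rw [Ideal.Quotient.eq_zero_iff_mem, Ideal.mem_span_singleton] at h1
    obtain ⟨m, rfl⟩ := h1
    refine ⟨m, ?_, rfl⟩
    rw [mul_pow] at hn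
    exact (mem_nonZeroDivisors_iff.mp (pow_mem hy 2)).1 _ hn
  have hI : ∀ (J : Ideal A), J ≤ Ideal.span {y} • J → J = ⊥ := fun J hJ =>
    Submodule.eq_bot_of_le_smul_of_le_jacobson_bot _ _ (IsNoetherian.noetherian J) hJ
      (by simpa [Ideal.span_le] using hyj)
  -- Square-zero elements are y times square-zero elements, so J = yJ and Nakayama applies.
  let J : Ideal A := Ideal.span {n : A | n ^ 2 = 0}
  have hJ : J = ⊥ := by
    refine hI J (Ideal.span_le.mpr fun n hn => ?_)
    obtain ⟨m, hm, rfl⟩ := key n hn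
    exact Submodule.smul_mem_smul (Ideal.mem_span_singleton_self y) (Ideal.subset_span hm)
  have : n ∈ J := Ideal.subset_span hn
  rwa [hJ] at this

theorem IsSeminormalRing.isReduced {A : Type*} [CommRing A] (h : IsSeminormalRing A) :
    IsReduced A := by
  refine (isReduced_iff_pow_one_lt 2 one_lt_two).mpr fun n hn => ?_
  obtain ⟨a, ha, ha'⟩ := h 0 n (by rw [hn]; ring)
  rw [← ha', pow_succ, ha, zero_mul]

/-- Supplies the denominator b + b' that lets c/b make sense when b is a zero divisor. If (b) +
Ann(b) had no regular element, some t ≠ 0 would kill it; then t is in Ann(b), so t² = 0. -/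
theorem exists_mul_eq_zero_add_mem_nonZeroDivisors {A : Type*} [CommRing A] [IsNoetherianRing A]
    [IsReduced A] (b : A) : ∃ b' : A, b * b' = 0 ∧ b + b' ∈ A⁰ := by
  by_contra! H
  let I : Ideal A := Ideal.span {b} ⊔ (Ideal.span {b}).annihilator
  by_cases hI : Disjoint (I : Set A) A⁰
  · obtain ⟨t, ht, ht0⟩ := SetLike.exists_of_lt
      (Ideal.bot_lt_annihilator_of_disjoint_nonZeroDivisors hI)
    refine ht0 ?_
    have htI : ∀ i ∈ I, t * i = 0 := fun i hi => Submodule.mem_annihilator.mp ht i hi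
    have htb : t * b = 0 := htI b (Ideal.mem_sup_left (Ideal.mem_span_singleton_self b))
    have : t ∈ I := Ideal.mem_sup_right (by
      rw [Submodule.mem_annihilator_span_singleton]; exact htb)
    have := htI t this
    exact eq_zero_of_pow_eq_zero (n := 2) (by rw [pow_two]; exact this)
  · obtain ⟨s, hs, hs0⟩ := Set.not_disjoint_iff.mp hI
    obtain ⟨b1, hb1, b', hb', rfl⟩ := Submodule.mem_sup.mp hs
    obtain ⟨r, rfl⟩ := Ideal.mem_span_singleton.mp hb1
    rw [Submodule.mem_annihilator_span_singleton, smul_eq_mul] at hb'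
    have hbb : b * b' = 0 := by rw [mul_comm]; exact hb'
    refine H b' hbb (mem_nonZeroDivisors_iff_right.mpr fun z hz => ?_)
    have h1 : z * b = 0 := by
      have h2 : (z * b) ^ 2 = 0 := by linear_combination z * b * hz - z^2 * hbb
      simpa using h2
    refine mem_nonZeroDivisors_iff_right.mp hs0 z ?_
    linear_combination (r - 1) * h1 + hz

/-! ### Denominator ideals, multiplier rings and integrality -/

section Conductor

variable {A K : Type*} [CommRing A] [CommRing K] [Algebra A K]

/-- The ideal of all `a` such that `a • x` lies in the image of `A`. -/
def denominatorIdeal (A : Type*) {K : Type*} [CommRing A] [CommRing K] [Algebra A K] (x : K) :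
    Ideal A :=
  (1 : Submodule A K).comap (LinearMap.toSpanSingleton A K x)

theorem mem_denominatorIdeal {x : K} {a : A} :
    a ∈ denominatorIdeal A x ↔ ∃ s : A, algebraMap A K s = a • x := by
  simp [denominatorIdeal, Submodule.mem_one]

/-- The `A`-subalgebra of all `u` with `u P ⊆ P`. -/
def multiplierRing (K : Type*) {A : Type*} [CommRing A] [CommRing K] [Algebra A K] (P : Ideal A) :
    Subalgebra A K where
  carrier := {u | ∀ q ∈ P, ∃ s ∈ P, algebraMap A K s = q • u}
  mul_mem' := by
    intro u v hu hv q hq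
    obtain ⟨s, hs, h1⟩ := hu q hq
    obtain ⟨t, ht, h2⟩ := hv s hs
    refine ⟨t, ht, ?_⟩
    rw [h2, ← smul_mul_assoc, ← h1, Algebra.smul_def]
  add_mem' := by
    intro u v hu hv q hq
    obtain ⟨s, hs, h1⟩ := hu q hq
    obtain ⟨t, ht, h2⟩ := hv q hq
    exact ⟨s + t, P.add_mem hs ht, by rw [map_add, h1, h2, smul_add]⟩
  algebraMap_mem' := by
    intro r q hq
    exact ⟨r * q, P.mul_mem_left r hq, by rw [Algebra.smul_def, map_mul, mul_comm]⟩

/-- The denominator ideal is the annihilator of the class of x in K/A, and the nonzero module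
generated by that class has an associated prime. -/
theorem exists_isPrime_denominatorIdeal_smul [IsNoetherianRing A] {x : K}
    (hx : x ∉ Set.range (algebraMap A K)) :
    ∃ a : A, (denominatorIdeal A (a • x)).IsPrime := by
  let N : Submodule A (K ⧸ (1 : Submodule A K)) :=
    Submodule.span A {Submodule.Quotient.mk x}
  have hN : Nontrivial N := by
    rw [Submodule.nontrivial_iff_ne_bot]
    intro h
    rw [Submodule.span_singleton_eq_bot, Submodule.Quotient.mk_eq_zero, Submodule.mem_one] at h
    exact hx h
  obtain ⟨P, hP⟩ := associatedPrimes.nonempty A N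
  rw [AssociatedPrimes.mem_iff, isAssociatedPrime_iff] at hP
  obtain ⟨hprime, ⟨n, hn⟩, hP⟩ := hP
  obtain ⟨a, rfl⟩ := Submodule.mem_span_singleton.mp hn
  refine ⟨a, ?_⟩
  convert hprime
  rw [hP]
  ext t
  rw [Submodule.mem_colon_singleton, mem_denominatorIdeal, Submodule.mem_bot,
    ← Submodule.mem_one, ← Submodule.Quotient.mk_eq_zero, Subtype.ext_iff]
  rfl

section

variable [FaithfulSMul A K]

/-- For π in P, an integral equation of x scaled by π shows that (πx)^n is in P, so πx is in P.
Hence (uπ)x = u(πx) is in A, that is, uπ is in P. -/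
theorem mem_multiplierRing_of_isPrime {x : K} (hx : IsIntegral A x)
    (hP : (denominatorIdeal A x).IsPrime) {u : K}
    (hu : ∀ q ∈ denominatorIdeal A x, ∃ s : A, algebraMap A K s = q • u) :
    u ∈ multiplierRing K (denominatorIdeal A x) := by
  have hinj := FaithfulSMul.algebraMap_injective A K
  set P := denominatorIdeal A x
  intro π hπ
  obtain ⟨s, hs⟩ := hu π hπ
  refine ⟨s, by_contra fun hsP => hsP ?_, hs⟩
  obtain ⟨r, hr⟩ := mem_denominatorIdeal.mp hπ
  have key : r ∈ P := by
    obtain ⟨p, hp, hpx⟩ := hx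
    have h1 : aeval (algebraMap A K π * x) (p.scaleRoots π) = 0 := scaleRoots_aeval_eq_zero hpx
    rw [← Algebra.smul_def, ← hr, aeval_algebraMap_apply] at h1
    have h2 : aeval r (p.scaleRoots π) = 0 := hinj (by simpa using h1)
    rw [coe_aeval_eq_eval] at h2
    have h3 : Ideal.Quotient.mk P (eval r (p.scaleRoots π)) = 0 := by rw [h2, map_zero]
    rw [← eval₂_at_apply, ← eval_map, map_scaleRoots _ _ _ (by
      rw [hp.leadingCoeff, map_one]
      have := hP
      exact one_ne_zero), Ideal.Quotient.eq_zero_iff_mem.mpr hπ, scaleRoots_zero,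
      (hp.map _).leadingCoeff] at h3
    simp only [one_smul, eval_pow, eval_X] at h3
    exact Ideal.Quotient.eq_zero_iff_mem.mp
      (by have := hP; exact eq_zero_of_pow_eq_zero h3)
  obtain ⟨t, ht⟩ := hu r key
  refine mem_denominatorIdeal.mpr ⟨t, ?_⟩
  rw [ht, Algebra.smul_def, hr, Algebra.smul_def s, hs, Algebra.smul_def, Algebra.smul_def]
  ring

/-- Scaling an integral equation of z by y gives a^n in yA, and A/yA is reduced. -/
theorem exists_eq_of_smul_eq {y : A} (hred : IsReduced (A ⧸ Ideal.span {y}))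
    (hyK : algebraMap A K y ∈ K⁰) {z : K} (hz : IsIntegral A z) {a : A}
    (ha : algebraMap A K a = y • z) : ∃ b : A, algebraMap A K b = z ∧ a = y * b := by
  have hinj := FaithfulSMul.algebraMap_injective A K
  obtain ⟨p, hp, hpx⟩ := hz
  have h1 : aeval (algebraMap A K y * z) (p.scaleRoots y) = 0 := scaleRoots_aeval_eq_zero hpx
  rw [← Algebra.smul_def, ← ha, aeval_algebraMap_apply] at h1
  have h2 : aeval a (p.scaleRoots y) = 0 := hinj (by simpa using h1)
  rw [coe_aeval_eq_eval] at h2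
  have hay : Ideal.Quotient.mk (Ideal.span {y}) a = 0 := by
    rcases subsingleton_or_nontrivial (A ⧸ Ideal.span {y}) with _ | _
    · exact Subsingleton.elim _ _
    have h3 : Ideal.Quotient.mk (Ideal.span {y}) (eval a (p.scaleRoots y)) = 0 := by
      rw [h2, map_zero]
    rw [← eval₂_at_apply, ← eval_map, map_scaleRoots _ _ _ (by
      rw [hp.leadingCoeff, map_one]
      exact one_ne_zero),
      Ideal.Quotient.eq_zero_iff_mem.mpr (Ideal.mem_span_singleton_self y), scaleRoots_zero,
      (hp.map _).leadingCoeff] at h3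
    simp only [one_smul, eval_pow, eval_X] at h3
    exact eq_zero_of_pow_eq_zero h3
  rw [Ideal.Quotient.eq_zero_iff_mem, Ideal.mem_span_singleton] at hay
  obtain ⟨b, rfl⟩ := hay
  refine ⟨b, ?_, rfl⟩
  rw [map_mul, Algebra.smul_def] at ha
  exact (mul_cancel_left_mem_nonZeroDivisors hyK).mp ha

theorem exists_eq_of_pow_smul_eq {y : A} (hred : IsReduced (A ⧸ Ideal.span {y}))
    (hyK : algebraMap A K y ∈ K⁰) {n : ℕ} {z : K} (hz : IsIntegral A z) {a : A}
    (ha : algebraMap A K a = y ^ n • z) : ∃ b : A, algebraMap A K b = z := by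
  induction n generalizing a with
  | zero => exact ⟨a, by rw [ha, pow_zero, one_smul]⟩
  | succ n ih =>
    rw [pow_succ', mul_smul] at ha
    obtain ⟨b, hb, -⟩ := exists_eq_of_smul_eq hred hyK (hz.smul (y ^ n)) ha
    exact ih hb

end

variable [IsFractionRing A K]

theorem exists_mem_denominatorIdeal_nonZeroDivisors (x : K) :
    ∃ d ∈ denominatorIdeal A x, d ∈ A⁰ := by
  obtain ⟨c, d, rfl⟩ := IsLocalization.exists_mk'_eq A⁰ x
  refine ⟨d, mem_denominatorIdeal.mpr ⟨c, ?_⟩, d.2⟩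
  rw [Algebra.smul_def, mul_comm, IsLocalization.mk'_spec]

variable [IsNoetherianRing A]

/-- Multiplication by d embeds the multiplier ring into the Noetherian module A. -/
theorem fg_multiplierRing {P : Ideal A} {d : A} (hd : d ∈ P) (hd0 : d ∈ A⁰) :
    (Subalgebra.toSubmodule (multiplierRing K P)).FG := by
  have hdK := IsLocalization.map_units K (⟨d, hd0⟩ : A⁰)
  let f : K →ₗ[A] K := LinearMap.lsmul A K d
  have hf : Function.Injective f := by
    intro u v huv
    simp only [f, LinearMap.lsmul_apply, Algebra.smul_def] at huv
    exact hdK.mul_left_cancel huv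
  refine Submodule.fg_of_fg_map_injective f hf ?_
  refine Submodule.FG.of_le (T := (1 : Submodule A K)) ?_ ?_
  · rw [Submodule.one_eq_span]; exact Submodule.fg_span_singleton _
  · rintro _ ⟨u, hu, rfl⟩
    obtain ⟨s, -, hs⟩ := hu d hd
    exact Submodule.mem_one.mpr ⟨s, hs⟩

theorem isIntegral_of_mem_multiplierRing {P : Ideal A} {d : A} (hd : d ∈ P) (hd0 : d ∈ A⁰)
    {u : K} (hu : u ∈ multiplierRing K P) : IsIntegral A u :=
  IsIntegral.of_mem_of_fg _ (fg_multiplierRing hd hd0) _ hu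

end Conductor

/-! ### Reduction modulo y; normality and the condition at p -/

section Lifting

variable {A K : Type*} [CommRing A] [CommRing K] [Algebra A K] {x : K} {y : A}

theorem le_one_of_forall_exists_eq_add_smul (hyj : y ∈ Ideal.jacobson (⊥ : Ideal A))
    {N : Submodule A K} (hN : N.FG)
    (h : ∀ n ∈ N, ∃ a : A, ∃ w ∈ N, n = algebraMap A K a + y • w) :
    N ≤ 1 := by
  refine Submodule.le_of_le_smul_of_le_jacobson_bot (I := Ideal.span {y}) hN
    (by simpa [Ideal.span_le] using hyj) fun n hn => ?_
  obtain ⟨a, w, hw, rfl⟩ := h n hn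
  exact Submodule.add_mem_sup (Submodule.mem_one.mpr ⟨a, rfl⟩)
    (Submodule.smul_mem_smul (Ideal.mem_span_singleton_self y) hw)

theorem notMem_range_of_isPrime (hP : (denominatorIdeal A x).IsPrime) :
    x ∉ (1 : Submodule A K) := by
  intro h
  obtain ⟨b, hb⟩ := Submodule.mem_one.mp h
  refine hP.ne_top ((Ideal.eq_top_iff_one _).mpr (mem_denominatorIdeal.mpr ⟨b, ?_⟩))
  rw [hb, one_smul]

variable [IsFractionRing A K]

theorem notMem_denominatorIdeal (hx : IsIntegral A x) (hP : (denominatorIdeal A x).IsPrime)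
    (hy : y ∈ A⁰) (hred : IsReduced (A ⧸ Ideal.span {y})) : y ∉ denominatorIdeal A x := by
  intro h
  obtain ⟨a, ha⟩ := mem_denominatorIdeal.mp h
  have hyK := (IsLocalization.map_units K (⟨y, hy⟩ : A⁰)).mem_nonZeroDivisors
  obtain ⟨b, hb, -⟩ := exists_eq_of_smul_eq hred hyK hx ha
  refine hP.ne_top ((Ideal.eq_top_iff_one _).mpr (mem_denominatorIdeal.mpr ⟨b, ?_⟩))
  rw [hb, one_smul]

theorem self_mem_multiplierRing (hx : IsIntegral A x) (hP : (denominatorIdeal A x).IsPrime) :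
    x ∈ multiplierRing K (denominatorIdeal A x) :=
  mem_multiplierRing_of_isPrime hx hP fun _ hq => mem_denominatorIdeal.mp hq

/-- This is injectivity of M/yM → Q(A/yA). It suffices that z/y maps P into A: for q in P, d(qz) =
ysq, and d is regular modulo y, so y divides qz. -/
theorem exists_eq_smul_of_smul_eq (hx : IsIntegral A x) (hP : (denominatorIdeal A x).IsPrime)
    (hy : y ∈ A⁰) {d : A}
    (hd : Ideal.Quotient.mk (Ideal.span {y}) d ∈ (A ⧸ Ideal.span {y})⁰) {z : K}
    (hz : z ∈ multiplierRing K (denominatorIdeal A x)) {s : A}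
    (hs : algebraMap A K (y * s) = d • z) :
    ∃ w ∈ multiplierRing K (denominatorIdeal A x), z = y • w := by
  have hyu := IsLocalization.map_units K (⟨y, hy⟩ : A⁰)
  obtain ⟨v, hv⟩ := hyu.exists_right_inv
  have hinj := IsFractionRing.injective A K
  simp only at hv
  refine ⟨v * z, mem_multiplierRing_of_isPrime hx hP fun q hq => ?_, ?_⟩
  · obtain ⟨r, -, hr⟩ := hz q hq
    have h1 : d * r = y * (s * q) := hinj (by
      rw [map_mul, hr, ← mul_assoc y, map_mul _ (y * s), hs, Algebra.smul_def, Algebra.smul_def]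
      ring)
    have h2 : Ideal.Quotient.mk (Ideal.span {y}) r = 0 := by
      refine (mem_nonZeroDivisors_iff.mp hd).1 _ ?_
      rw [← map_mul, h1, Ideal.Quotient.eq_zero_iff_mem]
      exact Ideal.mul_mem_right _ _ (Ideal.mem_span_singleton_self y)
    rw [Ideal.Quotient.eq_zero_iff_mem, Ideal.mem_span_singleton] at h2
    obtain ⟨e, rfl⟩ := h2
    refine ⟨e, ?_⟩
    rw [map_mul, Algebra.smul_def] at hr
    rw [Algebra.smul_def]
    linear_combination v * hr - algebraMap A K e * hv
  · rw [Algebra.smul_def]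
    linear_combination (-z) * hv

/-- If an element of the multiplier ring, after multiplication by an element `d` regular modulo
`y`, is congruent modulo `y` to a multiple of `d`, then it lies in `A + y M`. -/
theorem exists_eq_add_smul (hx : IsIntegral A x) (hP : (denominatorIdeal A x).IsPrime)
    (hy : y ∈ A⁰) {d : A}
    (hd : Ideal.Quotient.mk (Ideal.span {y}) d ∈ (A ⧸ Ideal.span {y})⁰) {z : K}
    (hz : z ∈ multiplierRing K (denominatorIdeal A x)) {r a : A}
    (hr : algebraMap A K r = d • z)
    (h : Ideal.Quotient.mk (Ideal.span {y}) r = Ideal.Quotient.mk (Ideal.span {y}) (d * a)) :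
    ∃ w ∈ multiplierRing K (denominatorIdeal A x), z = algebraMap A K a + y • w := by
  rw [Ideal.Quotient.eq, Ideal.mem_span_singleton] at h
  obtain ⟨s, hs⟩ := h
  obtain ⟨w, hw, h⟩ := exists_eq_smul_of_smul_eq (z := z - algebraMap A K a) (s := s) hx hP hy hd
    (sub_mem hz (Subalgebra.algebraMap_mem _ a)) (by
      rw [← hs, map_sub, hr, smul_sub, map_mul, Algebra.smul_def d (algebraMap A K a)])
  exact ⟨w, hw, by rw [← h]; ring⟩

variable [IsNoetherianRing A]

/-- Otherwise some t outside yA satisfies tP ⊆ yA. As y is not in P, t/y maps P into P, so it is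
integral and t lies in yA after all. -/
theorem exists_mem_denominatorIdeal_mk_nonZeroDivisors (hx : IsIntegral A x)
    (hP : (denominatorIdeal A x).IsPrime) (hy : y ∈ A⁰)
    (hred : IsReduced (A ⧸ Ideal.span {y})) :
    ∃ d ∈ denominatorIdeal A x, Ideal.Quotient.mk (Ideal.span {y}) d ∈ (A ⧸ Ideal.span {y})⁰ := by
  by_contra! H
  have hyP := notMem_denominatorIdeal hx hP hy hred
  obtain ⟨d₀, hd₀, hd₀'⟩ := exists_mem_denominatorIdeal_nonZeroDivisors (A := A) x
  have hyu := IsLocalization.map_units K (⟨y, hy⟩ : A⁰)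
  set P := denominatorIdeal A x
  have hdisj : Disjoint ((P.map (Ideal.Quotient.mk (Ideal.span {y})) : Ideal _) : Set _)
      ((A ⧸ Ideal.span {y})⁰ : Set (A ⧸ Ideal.span {y})) := by
    rw [Set.disjoint_left]
    rintro a ha
    obtain ⟨d, hd, rfl⟩ := (Ideal.mem_map_iff_of_surjective _ Ideal.Quotient.mk_surjective).mp ha
    exact H d hd
  obtain ⟨t, ht, ht0⟩ := SetLike.exists_of_lt
      (Ideal.bot_lt_annihilator_of_disjoint_nonZeroDivisors hdisj)
  obtain ⟨t, rfl⟩ := Ideal.Quotient.mk_surjective t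
  obtain ⟨v, hv⟩ := hyu.exists_right_inv
  have hu : algebraMap A K t * v ∈ multiplierRing K P := by
    intro q hq
    have h1 := Submodule.mem_annihilator.mp ht _ (Ideal.mem_map_of_mem _ hq)
    rw [smul_eq_mul, ← map_mul, Ideal.Quotient.eq_zero_iff_mem, Ideal.mem_span_singleton] at h1
    obtain ⟨s, hs⟩ := h1
    refine ⟨s, (hP.mem_or_mem (hs ▸ P.mul_mem_left t hq : y * s ∈ P)).resolve_left hyP, ?_⟩
    have h2 := congrArg (algebraMap A K) hs
    rw [map_mul, map_mul] at h2
    rw [Algebra.smul_def]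
    simp only at hv
    linear_combination (-algebraMap A K s) * hv - v * h2
  obtain ⟨b, -, hb⟩ := exists_eq_of_smul_eq hred hyu.mem_nonZeroDivisors
    (isIntegral_of_mem_multiplierRing hd₀ hd₀' hu) (a := t) (by
      rw [Algebra.smul_def]
      simp only at hv
      linear_combination (-algebraMap A K t) * hv)
  refine ht0 ?_
  rw [Submodule.mem_bot, Ideal.Quotient.eq_zero_iff_mem, Ideal.mem_span_singleton]
  exact ⟨b, hb⟩

theorem denominatorIdeal_not_isPrime_of_isIntegrallyClosedIn
    (hyj : y ∈ Ideal.jacobson (⊥ : Ideal A)) (hy : y ∈ A⁰)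
    (hred : IsReduced (A ⧸ Ideal.span {y}))
    (hcl : IsIntegrallyClosedIn (A ⧸ Ideal.span {y}) (FractionRing (A ⧸ Ideal.span {y})))
    (hx : IsIntegral A x) : ¬ (denominatorIdeal A x).IsPrime := by
  intro hP
  obtain ⟨d₀, hd₀, hd₀'⟩ := exists_mem_denominatorIdeal_nonZeroDivisors (A := A) x
  obtain ⟨d, hdP, hd⟩ := exists_mem_denominatorIdeal_mk_nonZeroDivisors hx hP hy hred
  refine notMem_range_of_isPrime hP (le_one_of_forall_exists_eq_add_smul hyj
    (fg_multiplierRing hd₀ hd₀') (fun z hz => ?_) (self_mem_multiplierRing hx hP))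
  obtain ⟨r, -, hr⟩ := hz d hdP
  let R := A ⧸ Ideal.span {y}
  let π : A →+* R := Ideal.Quotient.mk (Ideal.span {y})
  let Q := FractionRing R
  obtain ⟨p, hp, hpz⟩ := isIntegral_of_mem_multiplierRing hd₀ hd₀' hz
  have h1 : aeval (algebraMap A K d * z) (p.scaleRoots d) = 0 := scaleRoots_aeval_eq_zero hpz
  rw [← Algebra.smul_def, ← hr, aeval_algebraMap_apply] at h1
  have h2 : aeval r (p.scaleRoots d) = 0 := IsFractionRing.injective A K (by simpa using h1)
  rw [coe_aeval_eq_eval] at h2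
  rcases subsingleton_or_nontrivial R with hR | hR
  · obtain ⟨w, hw, h⟩ := exists_eq_add_smul (a := 0) hx hP hy hd hz hr (Subsingleton.elim _ _)
    exact ⟨_, w, hw, h⟩
  have h3 : π (eval r (p.scaleRoots d)) = 0 := by rw [h2, map_zero]
  rw [← eval₂_at_apply, ← eval_map, map_scaleRoots _ _ _ (by
      rw [hp.leadingCoeff, map_one]
      exact one_ne_zero)] at h3
  have hdu := IsLocalization.map_units Q (⟨π d, hd⟩ : R⁰)
  obtain ⟨v, hv⟩ := hdu.exists_right_inv
  simp only at hv
  -- Unscaling the equation of r = dz modulo y gives an integral equation for the fraction r/d over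
  -- A/yA.
  have h4 : eval₂ (algebraMap R Q) (algebraMap R Q (π d) * (v * algebraMap R Q (π r)))
      ((p.map π).scaleRoots (π d)) = 0 := by
    rw [← mul_assoc, hv, one_mul, eval₂_at_apply, h3, map_zero]
  rw [scaleRoots_eval₂_mul] at h4
  have h5 : IsIntegral R (v * algebraMap R Q (π r)) :=
    ⟨p.map π, hp.map π, ((hdu.pow _).mul_right_eq_zero).mp h4⟩
  obtain ⟨a, ha⟩ := (isIntegrallyClosedIn_iff.mp hcl).2 h5
  obtain ⟨a, rfl⟩ := Ideal.Quotient.mk_surjective a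
  obtain ⟨w, hw, h⟩ := exists_eq_add_smul (a := a) hx hP hy hd hz hr
    (IsFractionRing.injective R Q (by
      rw [map_mul, map_mul, ha]
      linear_combination (-algebraMap R Q (π r)) * hv))
  exact ⟨_, w, hw, h⟩

theorem exists_eq_add_smul_of_pow_prime (hx : IsIntegral A x)
    (hP : (denominatorIdeal A x).IsPrime) (hy : y ∈ A⁰)
    (hwn : IsWeaklyNormalRing (A ⧸ Ideal.span {y})) {p : ℕ} (hp : p.Prime) {z : K}
    (hz : z ∈ multiplierRing K (denominatorIdeal A x)) {b e : A}
    (hb : algebraMap A K b = z ^ p) (he : algebraMap A K e = p * z) :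
    ∃ a : A, ∃ w ∈ multiplierRing K (denominatorIdeal A x), z = algebraMap A K a + y • w := by
  have hred := hwn.1.isReduced
  obtain ⟨d, hdP, hd⟩ := exists_mem_denominatorIdeal_mk_nonZeroDivisors hx hP hy hred
  obtain ⟨r, -, hr⟩ := hz d hdP
  have hinj := IsFractionRing.injective A K
  have h1 : r ^ p = b * d ^ p := hinj (by
    rw [map_pow, hr, map_mul, hb, Algebra.smul_def, mul_pow, map_pow, mul_comm])
  have h2 : (p : A) * r = d * e := hinj (by
    rw [map_mul, hr, map_mul, he, Algebra.smul_def, map_natCast]; ring)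
  let π := Ideal.Quotient.mk (Ideal.span {y})
  obtain ⟨a, ha, ha'⟩ := hwn.2 (π b) (π r) (π e) (π d) hd p hp
    (by rw [← map_pow, h1, map_mul, map_pow])
    (by rw [← map_natCast π, ← map_mul, h2, map_mul])
  obtain ⟨a, rfl⟩ := Ideal.Quotient.mk_surjective a
  obtain ⟨w, hw, h⟩ := exists_eq_add_smul (a := a) hx hP hy hd hz hr (by
    rw [← sub_eq_zero]
    refine eq_zero_of_pow_eq_zero (n := p) ?_
    -- With δ = r - da modulo y, pδ = 0 kills the mixed terms of (δ + da)^p, leaving δ^p = r^p -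
    -- (da)^p = 0.
    obtain ⟨t, ht⟩ := (Commute.all (π r - π (d * a)) (π (d * a))).exists_add_pow_prime_eq hp
    have h3 : (p : A ⧸ Ideal.span {y}) * (π r - π (d * a)) = 0 := by
      have := congrArg π h2
      rw [map_mul, map_mul, map_natCast, ha'] at this
      rw [map_mul]
      linear_combination this
    have h4 : π r ^ p = π (d * a) ^ p := by
      rw [← map_pow, h1, map_mul, ha, map_mul, mul_pow, map_pow, mul_comm]
    rw [sub_add_cancel, h3, h4] at ht
    linear_combination -ht)
  exact ⟨a, w, hw, h⟩

theorem denominatorIdeal_not_isPrime_of_pow_prime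
    (hyj : y ∈ Ideal.jacobson (⊥ : Ideal A)) (hy : y ∈ A⁰)
    (hwn : IsWeaklyNormalRing (A ⧸ Ideal.span {y})) {p : ℕ} (hp : p.Prime) {b e : A}
    (hb : algebraMap A K b = x ^ p) (he : algebraMap A K e = p * x) :
    ¬ (denominatorIdeal A x).IsPrime := by
  intro hP
  have hx : IsIntegral A x := IsIntegral.of_pow hp.pos (hb ▸ isIntegral_algebraMap)
  have hred := hwn.1.isReduced
  obtain ⟨d₀, hd₀, hd₀'⟩ := exists_mem_denominatorIdeal_nonZeroDivisors (A := A) x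
  have hyu := IsLocalization.map_units K (⟨y, hy⟩ : A⁰)
  have hpP : (p : A) ∈ denominatorIdeal A x :=
    mem_denominatorIdeal.mpr ⟨e, by rw [he, Algebra.smul_def, map_natCast]⟩
  let N : Submodule A K :=
    { carrier := {w | w ∈ multiplierRing K (denominatorIdeal A x) ∧
        ∃ s : A, algebraMap A K s = w ^ p}
      zero_mem' := ⟨zero_mem _, 0, by rw [map_zero, zero_pow hp.ne_zero]⟩
      add_mem' := by
        rintro u v ⟨hu, s, hs⟩ ⟨hv, t, ht⟩
        refine ⟨add_mem hu hv, ?_⟩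
        -- The mixed terms of (u + v)^p are p times an element of M, and p in P gives pM ⊆ A.
        obtain ⟨c, -, hc⟩ := mul_mem (mul_mem hu hv) (sum_mem (t := Finset.Ioo 0 p)
          (f := fun k => u ^ (k - 1) * v ^ (p - k - 1) * ((p.choose k / p : ℕ) : K))
          fun k _ => mul_mem (mul_mem (pow_mem hu _) (pow_mem hv _)) (natCast_mem _ _)) p hpP
        refine ⟨s + t + c, ?_⟩
        rw [(Commute.all u v).add_pow_prime_eq hp, map_add, map_add, hs, ht, hc, Algebra.smul_def,
          map_natCast]
        ring
      smul_mem' := by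
        rintro a u ⟨hu, s, hs⟩
        exact ⟨Subalgebra.smul_mem _ hu a, a ^ p * s, by
          rw [map_mul, hs, Algebra.smul_def, mul_pow, map_pow]⟩ }
  have hNM : N ≤ Subalgebra.toSubmodule (multiplierRing K (denominatorIdeal A x)) :=
    fun w hw => hw.1
  refine notMem_range_of_isPrime hP (le_one_of_forall_exists_eq_add_smul hyj
    (Submodule.FG.of_le (fg_multiplierRing hd₀ hd₀') hNM) ?_
    (show x ∈ N from ⟨self_mem_multiplierRing hx hP, b, hb⟩))
  rintro n ⟨hn, s, hs⟩
  obtain ⟨c, -, hc⟩ := hn p hpP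
  obtain ⟨a, w, hw, rfl⟩ := exists_eq_add_smul_of_pow_prime hx hP hy hwn hp hn hs
    (by rw [hc, Algebra.smul_def, map_natCast])
  refine ⟨a, w, ⟨hw, ?_⟩, rfl⟩
  have h1 : y • w ∈ N := by
    have h2 : (algebraMap A K a + y • w) - algebraMap A K a ∈ N :=
      N.sub_mem ⟨hn, s, hs⟩ ⟨Subalgebra.algebraMap_mem _ a, a ^ p, map_pow _ _ _⟩
    rwa [add_sub_cancel_left] at h2
  obtain ⟨-, t, ht⟩ := h1
  -- Since y^p w^p is in A and w is integral, w^p is in A: this keeps w inside N.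
  rw [Algebra.smul_def, mul_pow, ← map_pow, ← Algebra.smul_def] at ht
  exact exists_eq_of_pow_smul_eq hred hyu.mem_nonZeroDivisors
    ((isIntegral_of_mem_multiplierRing hd₀ hd₀' hw).pow p) ht

end Lifting

/-! ### Length at a prime -/

section Length

variable {A : Type*} [CommRing A]

/-- The length of the localization of `M` at the prime `Q`. -/
noncomputable def localLength (Q : Ideal A) [Q.IsPrime] (M : Type*) [AddCommGroup M] [Module A M] :
    ℕ∞ :=
  Module.length (Localization.AtPrime Q) (LocalizedModule Q.primeCompl M)

variable (Q : Ideal A) [Q.IsPrime] {M N P : Type*} [AddCommGroup M] [Module A M]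
  [AddCommGroup N] [Module A N] [AddCommGroup P] [Module A P]

theorem localLength_eq_add_of_exact (f : N →ₗ[A] M) (g : M →ₗ[A] P) (hf : Function.Injective f)
    (hg : Function.Surjective g) (H : Function.Exact f g) :
    localLength Q M = localLength Q N + localLength Q P :=
  Module.length_eq_add_of_exact (LocalizedModule.map Q.primeCompl f)
    (LocalizedModule.map Q.primeCompl g) (LocalizedModule.map_injective _ f hf)
    (LocalizedModule.map_surjective _ g hg) (LocalizedModule.map_exact _ f g H)

theorem localLength_le_of_injective (f : N →ₗ[A] M) (hf : Function.Injective f) :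
    localLength Q N ≤ localLength Q M :=
  Module.length_le_of_injective (LocalizedModule.map Q.primeCompl f)
    (LocalizedModule.map_injective _ f hf)

theorem localLength_quotient_ne_zero : localLength Q (A ⧸ Q) ≠ 0 := by
  rw [localLength, Ne, Module.length_eq_zero_iff, LocalizedModule.subsingleton_iff]
  intro h
  obtain ⟨r, hr, h⟩ := h (Ideal.Quotient.mk Q 1)
  refine hr ?_
  rw [Algebra.smul_def, map_one, mul_one] at h
  exact Ideal.Quotient.eq_zero_iff_mem.mp h

variable {Q} in
theorem localLength_ne_top [IsNoetherianRing A] [Module.Finite A M] {I : Ideal A}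
    (hQ : Q ∈ I.minimalPrimes) (h : ∀ i ∈ I, ∀ m : M, i • m = 0) : localLength Q M ≠ ⊤ := by
  let S := Localization.AtPrime Q
  let I' := I.map (algebraMap A S)
  have hmin : IsLocalRing.maximalIdeal S ∈ I'.minimalPrimes := by
    rwa [IsLocalization.minimalPrimes_map Q.primeCompl S I,
      Set.mem_preimage, Localization.AtPrime.under_maximalIdeal]
  have : IsArtinianRing (S ⧸ I') :=
    IsLocalRing.quotient_artinian_of_mem_minimalPrimes_of_isLocalRing I' hmin
  let M' := LocalizedModule Q.primeCompl M
  have htors : Module.IsTorsionBySet S M' I' := by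
    rw [Module.isTorsionBySet_iff_subset_annihilator]
    change I' ≤ Module.annihilator S M'
    refine Ideal.map_le_iff_le_comap.mpr fun i hi => ?_
    rw [Ideal.mem_comap, Module.mem_annihilator]
    intro m
    induction m using LocalizedModule.induction_on with
    | _ m s =>
      rw [algebraMap_smul, LocalizedModule.smul'_mk, h i hi m, LocalizedModule.zero_mk]
  let _ := htors.module
  have : IsScalarTower S (S ⧸ I') M' := htors.isScalarTower
  have : Module.Finite S M' := inferInstance
  have : Module.Finite (S ⧸ I') M' := Module.Finite.of_restrictScalars_finite S _ _
  have : IsArtinian (S ⧸ I') M' := inferInstance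
  have : IsArtinian S M' :=
    isArtinian_of_surjective_algebraMap (R := S ⧸ I') Ideal.Quotient.mk_surjective
  exact Module.length_ne_top

end Length

/-! ### A length comparison for modules that are cyclic up to powers of y -/

section Cyclic

variable {A : Type*} [CommRing A] [IsNoetherianRing A] {N : Type*} [AddCommGroup N] [Module A N]
  [Module.Finite A N] {P Q : Ideal A} {y : A}

/-- If `A ⧸ P` embeds into `N` with cokernel killed by a power of an `N`-regular element `y`, and
`Q` is minimal over `P + (y)`, then `N / y N` and `A / (P + (y))` have the same finite length
at `Q`. -/
theorem localLength_quotient_range_lsmul [Q.IsPrime]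
    (hQ : Q ∈ (P ⊔ Ideal.span {y}).minimalPrimes)
    (hPN : ∀ q ∈ P, ∀ n : N, q • n = 0) (hyN : Function.Injective (LinearMap.lsmul A N y))
    (g : A →ₗ[A] N) (hg : LinearMap.ker g = P) {k : ℕ}
    (hk : ∀ n : N, y ^ k • n ∈ LinearMap.range g) :
    localLength Q (N ⧸ LinearMap.range (LinearMap.lsmul A N y)) =
      localLength Q (A ⧸ P ⊔ Ideal.span {y}) := by
  let X := LinearMap.range g
  let f : N →ₗ[A] N := LinearMap.lsmul A N y
  let Y := X.map f
  have hYX : Y ≤ X := by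
    rintro _ ⟨n, hn, rfl⟩
    exact X.smul_mem y hn
  have hYf : Y ≤ LinearMap.range f := LinearMap.map_le_range
  -- Two filtrations of N/yX are compared: through yN, where yN/yX ≅ N/X, and through X, where X/yX
  -- ≅ A/(P + yA). The finite length of N/X then cancels.
  have h1 : localLength Q (N ⧸ Y) = localLength Q (N ⧸ X) + localLength Q (N ⧸ LinearMap.range f) := by
    refine localLength_eq_add_of_exact Q (X.mapQ Y f (Submodule.le_comap_map _ _))
      (Submodule.factor hYf) ?_ (Submodule.factor_surjective hYf) ?_
    · rw [← LinearMap.ker_eq_bot, Submodule.ker_mapQ, Submodule.comap_map_eq_of_injective hyN,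
        Submodule.mkQ_map_self]
    · intro n
      obtain ⟨n, rfl⟩ := Submodule.Quotient.mk_surjective _ n
      have e : Submodule.factor hYf (Submodule.Quotient.mk n) = Submodule.Quotient.mk n := rfl
      rw [e, Submodule.Quotient.mk_eq_zero]
      constructor
      · rintro ⟨m, rfl⟩
        exact ⟨Submodule.Quotient.mk m, rfl⟩
      · rintro ⟨m, hm⟩
        obtain ⟨m, rfl⟩ := Submodule.Quotient.mk_surjective _ m
        rw [Submodule.mapQ_apply, Submodule.Quotient.eq] at hm
        have h2 := Submodule.sub_mem _ (LinearMap.mem_range_self f m) (hYf hm)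
        rwa [sub_sub_cancel] at h2
  have hker : LinearMap.ker (Y.mkQ ∘ₗ g) = P ⊔ Ideal.span {y} := by
    ext a
    rw [LinearMap.mem_ker, LinearMap.comp_apply, Submodule.mkQ_apply, Submodule.Quotient.mk_eq_zero]
    constructor
    · rintro ⟨_, ⟨b, rfl⟩, hb⟩
      have h2 : a - y * b ∈ P := by
        rw [← hg, LinearMap.mem_ker, map_sub, ← hb, ← smul_eq_mul, map_smul]
        exact sub_self _
      rw [← sub_add_cancel a (y * b)]
      exact Submodule.add_mem_sup h2 (Ideal.mul_mem_right _ _ (Ideal.mem_span_singleton_self y))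
    · intro ha
      obtain ⟨q, hq, c, hc, rfl⟩ := Submodule.mem_sup.mp ha
      obtain ⟨b, rfl⟩ := Ideal.mem_span_singleton.mp hc
      rw [← hg, LinearMap.mem_ker] at hq
      rw [map_add, hq, zero_add, ← smul_eq_mul, map_smul]
      exact ⟨g b, ⟨b, rfl⟩, rfl⟩
  have h2 : localLength Q (N ⧸ Y) =
      localLength Q (A ⧸ P ⊔ Ideal.span {y}) + localLength Q (N ⧸ X) := by
    refine localLength_eq_add_of_exact Q
      ((P ⊔ Ideal.span {y}).liftQ (Y.mkQ ∘ₗ g) hker.ge) (Submodule.factor hYX) ?_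
      (Submodule.factor_surjective hYX) ?_
    · rw [← LinearMap.ker_eq_bot]
      exact Submodule.ker_liftQ_eq_bot _ _ _ hker.le
    · intro n
      obtain ⟨n, rfl⟩ := Submodule.Quotient.mk_surjective _ n
      have e : Submodule.factor hYX (Submodule.Quotient.mk n) = Submodule.Quotient.mk n := rfl
      rw [e, Submodule.Quotient.mk_eq_zero]
      constructor
      · rintro ⟨a, rfl⟩
        exact ⟨Submodule.Quotient.mk a, rfl⟩
      · rintro ⟨a, ha⟩
        obtain ⟨a, rfl⟩ := Submodule.Quotient.mk_surjective _ a
        rw [Submodule.liftQ_apply, LinearMap.comp_apply, Submodule.mkQ_apply,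
          Submodule.Quotient.eq] at ha
        have h2 := Submodule.sub_mem _ (LinearMap.mem_range_self g a) (hYX ha)
        rwa [sub_sub_cancel] at h2
  -- The exponent k + 1 keeps the ideal inside Q even when k = 0.
  have hmin : Q ∈ (P ⊔ Ideal.span {y ^ (k + 1)}).minimalPrimes := by
    refine ⟨⟨inferInstance, sup_le (le_sup_left.trans hQ.1.2) ?_⟩, fun J hJ hJQ => ?_⟩
    · rw [Ideal.span_singleton_le_iff_mem]
      exact Ideal.pow_mem_of_mem _ (hQ.1.2 (Ideal.mem_sup_right (Ideal.mem_span_singleton_self y)))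
        _ k.succ_pos
    · refine hQ.2 ⟨hJ.1, sup_le (le_sup_left.trans hJ.2) ?_⟩ hJQ
      rw [Ideal.span_singleton_le_iff_mem]
      exact hJ.1.mem_of_pow_mem _ (hJ.2 (Ideal.mem_sup_right (Ideal.mem_span_singleton_self _)))
  have hfin : localLength Q (N ⧸ X) ≠ ⊤ := by
    refine localLength_ne_top hmin fun i hi n => ?_
    obtain ⟨n, rfl⟩ := Submodule.Quotient.mk_surjective _ n
    rw [← Submodule.Quotient.mk_smul, Submodule.Quotient.mk_eq_zero]
    obtain ⟨q, hq, c, hc, rfl⟩ := Submodule.mem_sup.mp hi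
    obtain ⟨b, rfl⟩ := Ideal.mem_span_singleton.mp hc
    rw [add_smul, hPN q hq, zero_add, mul_comm, mul_smul, pow_succ', mul_smul]
    exact X.smul_mem b (X.smul_mem y (hk n))
  rw [h1, add_comm] at h2
  exact (ENat.add_left_injective_of_ne_top hfin) h2

/-- N/yN embeds into A/(P + yA) with equal finite length at Q, whereas Q/(P + yA) has strictly
smaller length there. -/
theorem not_forall_mem_of_ker_le_range_lsmul [Q.IsPrime]
    (hQ : Q ∈ (P ⊔ Ideal.span {y}).minimalPrimes)
    (hPN : ∀ q ∈ P, ∀ n : N, q • n = 0) (hyN : Function.Injective (LinearMap.lsmul A N y))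
    (g : A →ₗ[A] N) (hg : LinearMap.ker g = P) {k : ℕ}
    (hk : ∀ n : N, y ^ k • n ∈ LinearMap.range g)
    (φ : N →ₗ[A] A ⧸ P ⊔ Ideal.span {y})
    (hφ : LinearMap.ker φ ≤ LinearMap.range (LinearMap.lsmul A N y)) :
    ¬ ∀ n, Submodule.factor hQ.1.2 (φ n) = 0 := by
  intro H
  have hlen := localLength_quotient_range_lsmul hQ hPN hyN g hg hk
  have hle : LinearMap.range (LinearMap.lsmul A N y) ≤ LinearMap.ker φ := by
    rintro _ ⟨n, rfl⟩
    obtain ⟨a, ha⟩ := Submodule.Quotient.mk_surjective _ (φ n)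
    rw [LinearMap.mem_ker, LinearMap.lsmul_apply, map_smul, ← ha, ← Submodule.Quotient.mk_smul,
      Submodule.Quotient.mk_eq_zero, smul_eq_mul]
    exact Ideal.mem_sup_right (Ideal.mul_mem_right _ _ (Ideal.mem_span_singleton_self y))
  let ψ : (N ⧸ LinearMap.range (LinearMap.lsmul A N y)) →ₗ[A] A ⧸ P ⊔ Ideal.span {y} :=
    Submodule.liftQ _ φ hle
  have hψ : Function.Injective ψ := by
    rw [← LinearMap.ker_eq_bot]
    exact Submodule.ker_liftQ_eq_bot _ _ _ hφ
  let τ : (A ⧸ P ⊔ Ideal.span {y}) →ₗ[A] A ⧸ Q := Submodule.factor hQ.1.2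
  have hτ : localLength Q (A ⧸ P ⊔ Ideal.span {y}) =
      localLength Q (LinearMap.ker τ) + localLength Q (A ⧸ Q) :=
    localLength_eq_add_of_exact Q (LinearMap.ker τ).subtype τ (Submodule.subtype_injective _)
      (Submodule.factor_surjective _) (LinearMap.exact_subtype_ker_map τ)
  have hψτ : ∀ n, ψ n ∈ LinearMap.ker τ := by
    intro n
    obtain ⟨n, rfl⟩ := Submodule.Quotient.mk_surjective _ n
    exact H n
  have hle' : localLength Q (N ⧸ LinearMap.range (LinearMap.lsmul A N y)) ≤
      localLength Q (LinearMap.ker τ) :=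
    localLength_le_of_injective Q (ψ.codRestrict _ hψτ)
      (fun a b hab => hψ (congrArg Subtype.val hab))
  have hfin : localLength Q (A ⧸ P ⊔ Ideal.span {y}) ≠ ⊤ := by
    refine localLength_ne_top hQ fun i hi n => ?_
    obtain ⟨n, rfl⟩ := Submodule.Quotient.mk_surjective _ n
    rw [← Submodule.Quotient.mk_smul, Submodule.Quotient.mk_eq_zero]
    exact Ideal.mul_mem_right _ _ hi
  rw [hlen] at hle'
  have hker : localLength Q (LinearMap.ker τ) ≠ ⊤ := by
    intro h
    rw [hτ, h, top_add] at hfin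
    exact hfin rfl
  refine localLength_quotient_ne_zero Q ?_
  rw [hτ] at hle'
  generalize localLength Q (LinearMap.ker τ) = u at *
  generalize localLength Q (A ⧸ Q) = v at *
  have : u + v ≤ u + 0 := by simpa using hle'
  exact le_zero_iff.mp ((ENat.add_le_add_iff_left hker).mp this)

end Cyclic

/-! ### Seminormality -/

section Seminormal

variable {A K : Type*} [CommRing A] [CommRing K] [Algebra A K] [IsFractionRing A K]
  {x : K} {y : A}

theorem exists_mem_of_pow_smul_eq (hx : IsIntegral A x) (hP : (denominatorIdeal A x).IsPrime)
    (hy : y ∈ A⁰) (hred : IsReduced (A ⧸ Ideal.span {y})) {z : K} (hz : IsIntegral A z) {k : ℕ}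
    {v : A} (hv : v ∈ denominatorIdeal A x) (h : algebraMap A K v = y ^ k • z) :
    ∃ s ∈ denominatorIdeal A x, algebraMap A K s = z := by
  have hyu := IsLocalization.map_units K (⟨y, hy⟩ : A⁰)
  obtain ⟨s, hs⟩ := exists_eq_of_pow_smul_eq hred hyu.mem_nonZeroDivisors hz h
  refine ⟨s, ?_, hs⟩
  have h1 : v = y ^ k * s := IsFractionRing.injective A K (by
    rw [h, map_mul, hs, Algebra.smul_def])
  refine (hP.mem_or_mem (h1 ▸ hv)).resolve_left fun h2 => ?_
  exact notMem_denominatorIdeal hx hP hy hred (hP.mem_of_pow_mem k h2)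

variable [IsNoetherianRing A]

theorem exists_eq_add_smul_of_isSeminormalRing (hx : IsIntegral A x)
    (hP : (denominatorIdeal A x).IsPrime) (hy : y ∈ A⁰)
    (hsn : IsSeminormalRing (A ⧸ Ideal.span {y})) {z : K}
    (hz : z ∈ multiplierRing K (denominatorIdeal A x)) {b c : A}
    (hb : algebraMap A K b = z ^ 2) (hc : algebraMap A K c = z ^ 3) :
    ∃ a : A, ∃ w ∈ multiplierRing K (denominatorIdeal A x), z = algebraMap A K a + y • w := by
  have hred := hsn.isReduced
  obtain ⟨d, hdP, hd⟩ := exists_mem_denominatorIdeal_mk_nonZeroDivisors hx hP hy hred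
  obtain ⟨r, -, hr⟩ := hz d hdP
  rw [Algebra.smul_def] at hr
  have hinj := IsFractionRing.injective A K
  have h0 : b ^ 3 = c ^ 2 := hinj (by rw [map_pow, map_pow, hb, hc]; ring)
  have h1 : r ^ 2 = d ^ 2 * b := hinj (by rw [map_pow, hr, map_mul, hb, map_pow]; ring)
  have h2 : r ^ 3 = d ^ 3 * c := hinj (by rw [map_pow, hr, map_mul, hc, map_pow]; ring)
  let π := Ideal.Quotient.mk (Ideal.span {y})
  obtain ⟨a, ha, ha'⟩ := hsn (π b) (π c) (by rw [← map_pow, h0, map_pow])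
  obtain ⟨a, rfl⟩ := Ideal.Quotient.mk_surjective a
  have h3 : π r ^ 2 = π (d * a) ^ 2 := by
    rw [← map_pow, h1, map_mul, ← ha, map_mul, mul_pow, map_pow]
  have h4 : π r ^ 3 = π (d * a) ^ 3 := by
    rw [← map_pow, h2, map_mul, ← ha', map_mul, mul_pow, map_pow]
  obtain ⟨w, hw, h⟩ := exists_eq_add_smul (a := a) hx hP hy hd hz (r := r)
    (by rw [hr, Algebra.smul_def]) (by
      rw [← sub_eq_zero]
      refine eq_zero_of_pow_eq_zero (n := 3) ?_
      -- With u = r and v = da: (u - v)³ = 4(u³ - v³) - 3(u + v)(u² - v²).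
      linear_combination 4 * h4 - 3 * (π (d * a) + π r) * h3)
  exact ⟨a, w, hw, h⟩

/-- The elements of the multiplier ring which some power of `y` moves into `A x + P`. -/
def saturation (A : Type*) {K : Type*} [CommRing A] [CommRing K] [Algebra A K] (x : K) (y : A) :
    Submodule A K where
  carrier := {n | n ∈ multiplierRing K (denominatorIdeal A x) ∧
    ∃ k : ℕ, ∃ a : A, ∃ q ∈ denominatorIdeal A x, y ^ k • n = a • x + algebraMap A K q}
  zero_mem' := ⟨zero_mem _, 0, 0, 0, zero_mem _, by simp⟩
  add_mem' := by
    rintro m n ⟨hm, k, a, q, hq, h⟩ ⟨hn, l, b, r, hr, h'⟩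
    refine ⟨add_mem hm hn, k + l, y ^ l * a + y ^ k * b, y ^ l * q + y ^ k * r,
      add_mem (Ideal.mul_mem_left _ _ hq) (Ideal.mul_mem_left _ _ hr), ?_⟩
    simp only [Algebra.smul_def, map_add, map_mul, map_pow] at h h' ⊢
    linear_combination algebraMap A K y ^ l * h + algebraMap A K y ^ k * h'
  smul_mem' := by
    rintro c m ⟨hm, k, a, q, hq, h⟩
    refine ⟨Subalgebra.smul_mem _ hm c, k, c * a, c * q, Ideal.mul_mem_left _ _ hq, ?_⟩
    simp only [Algebra.smul_def, map_mul, map_pow] at h ⊢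
    linear_combination algebraMap A K c * h

theorem denominatorIdeal_not_isPrime_of_isSeminormalRing
    (hyj : y ∈ Ideal.jacobson (⊥ : Ideal A)) (hy : y ∈ A⁰)
    (hsn : IsSeminormalRing (A ⧸ Ideal.span {y})) {b c : A}
    (hb : algebraMap A K b = x ^ 2) (hc : algebraMap A K c = x ^ 3) :
    ¬ (denominatorIdeal A x).IsPrime := by
  intro hP
  have hred := hsn.isReduced
  have hinj := IsFractionRing.injective A K
  have hx : IsIntegral A x := IsIntegral.of_pow two_pos (hb ▸ isIntegral_algebraMap)
  have hyu := IsLocalization.map_units K (⟨y, hy⟩ : A⁰)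
  obtain ⟨d₀, hd₀, hd₀'⟩ := exists_mem_denominatorIdeal_nonZeroDivisors (A := A) x
  have hxM := self_mem_multiplierRing hx hP
  have hbP : b ∈ denominatorIdeal A x :=
    mem_denominatorIdeal.mpr ⟨c, by rw [hc, Algebra.smul_def, hb]; ring⟩
  set P := denominatorIdeal A x
  have hint : ∀ u ∈ multiplierRing K P, IsIntegral A u :=
    fun u hu => isIntegral_of_mem_multiplierRing hd₀ hd₀' hu
  let N := saturation A x y
  have hNM : ∀ n ∈ N, n ∈ multiplierRing K P := fun n hn => hn.1
  have hxN : x ∈ N := ⟨hxM, 0, 1, 0, zero_mem _, by simp⟩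
  have hNfg : N.FG := Submodule.FG.of_le (fg_multiplierRing hd₀ hd₀') hNM
  have hsq : ∀ n ∈ N, ∃ s ∈ P, algebraMap A K s = n ^ 2 := by
    rintro n ⟨hn, k, a, q, hq, h⟩
    obtain ⟨t, ht, htq⟩ := hxM q hq
    -- The witness is (ax + q)² = y^(2k) n², with x² = b and qx = t, all three terms lying in P.
    refine exists_mem_of_pow_smul_eq hx hP hy hred ((hint n hn).pow 2) (k := 2 * k)
      (v := a ^ 2 * b + 2 * a * t + q * q)
      (add_mem (add_mem (P.mul_mem_left _ hbP) (P.mul_mem_left _ ht)) (P.mul_mem_left _ hq)) ?_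
    simp only [Algebra.smul_def, map_add, map_mul, map_pow, map_ofNat, pow_mul'] at h htq ⊢
    rw [hb, htq, ← mul_pow (algebraMap A K y ^ k), h]
    ring
  have hdecomp : ∀ n : N, ∃ s : A, ∃ w ∈ multiplierRing K P, (n : K) = algebraMap A K s + y • w := by
    rintro ⟨n, hn⟩
    obtain ⟨s, hs, h⟩ := hsq n hn
    obtain ⟨t, -, ht⟩ := hn.1 s hs
    exact exists_eq_add_smul_of_isSeminormalRing hx hP hy hsn hn.1 h (c := t)
      (by rw [ht, Algebra.smul_def, h]; ring)
  have huniq : ∀ {s s' : A} {w w' : K}, w ∈ multiplierRing K P → w' ∈ multiplierRing K P →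
      algebraMap A K s + y • w = algebraMap A K s' + y • w' → s - s' ∈ P ⊔ Ideal.span {y} := by
    intro s s' w w' hw hw' h
    obtain ⟨e, -, he⟩ := exists_eq_of_smul_eq (a := s - s') hred hyu.mem_nonZeroDivisors
      (hint _ (sub_mem hw' hw)) (by rw [map_sub, smul_sub]; linear_combination h)
    rw [he]
    exact Ideal.mem_sup_right (Ideal.mul_mem_right _ _ (Ideal.mem_span_singleton_self y))
  choose σ w hw hσ using hdecomp
  have hmk : ∀ {s s' : A}, s - s' ∈ P ⊔ Ideal.span {y} →
      (Submodule.Quotient.mk s : A ⧸ P ⊔ Ideal.span {y}) = Submodule.Quotient.mk s' :=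
    fun h => (Submodule.Quotient.eq _).mpr h
  -- The residue of s in n = s + yw is well defined by `huniq`, hence linear in n although `σ` is
  -- only a choice.
  let φ : N →ₗ[A] A ⧸ P ⊔ Ideal.span {y} :=
    { toFun n := Submodule.Quotient.mk (σ n)
      map_add' := fun m n => by
        rw [← Submodule.Quotient.mk_add]
        refine hmk (huniq (hw (m + n)) (add_mem (hw m) (hw n)) ?_)
        rw [← hσ, Submodule.coe_add, hσ m, hσ n, map_add, smul_add]
        ring
      map_smul' := fun a n => by
        rw [RingHom.id_apply, ← Submodule.Quotient.mk_smul]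
        refine hmk (huniq (hw (a • n)) (Subalgebra.smul_mem _ (hw n) a) ?_)
        rw [← hσ, Submodule.coe_smul, hσ n, smul_eq_mul, map_mul, smul_add, Algebra.smul_def a,
          smul_comm] }
  let PN : Submodule A N := (Submodule.map (Algebra.linearMap A K) P).comap N.subtype
  have hmemPN : ∀ {n : N}, n ∈ PN ↔ ∃ q ∈ P, algebraMap A K q = n := Iff.rfl
  have hPφ : PN ≤ LinearMap.ker φ := by
    intro n hn
    obtain ⟨q, hq, h⟩ := hmemPN.mp hn
    refine (Submodule.Quotient.mk_eq_zero _).mpr ?_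
    have h1 := huniq (s' := q) (hw n) (zero_mem _) (by rw [← hσ, h, smul_zero, add_zero])
    simpa using add_mem h1 (Ideal.mem_sup_left hq)
  have : Module.Finite A N := Module.Finite.of_fg hNfg
  obtain ⟨Q, hQ⟩ : (P ⊔ Ideal.span {y}).minimalPrimes.Nonempty := by
    refine Set.nonempty_coe_sort.mp (Ideal.nonempty_minimalPrimes (I := P ⊔ Ideal.span {y}) fun h => ?_)
    obtain ⟨m, hm, hPm⟩ := Ideal.exists_le_maximal P hP.ne_top
    refine hm.ne_top (top_le_iff.mp (h ▸ sup_le hPm ?_))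
    rw [Ideal.span_singleton_le_iff_mem]
    exact Ideal.mem_sInf.mp hyj ⟨bot_le, hm⟩
  have hQp : Q.IsPrime := hQ.1.1
  let g : A →ₗ[A] N ⧸ PN := PN.mkQ ∘ₗ LinearMap.toSpanSingleton A N ⟨x, hxN⟩
  have hg : LinearMap.ker g = P := by
    ext a
    rw [LinearMap.mem_ker, LinearMap.comp_apply, Submodule.mkQ_apply,
      Submodule.Quotient.mk_eq_zero, hmemPN]
    exact ⟨fun ⟨q, _, h⟩ => mem_denominatorIdeal.mpr ⟨q, h⟩, fun ha => hxM a ha⟩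
  -- Finite generation of N makes one exponent serve all of its elements.
  obtain ⟨k, hk⟩ : ∃ k : ℕ, ∀ n ∈ N, ∃ a : A, ∃ q ∈ P,
      y ^ k • n = a • x + algebraMap A K q := by
    obtain ⟨S, hS⟩ := hNfg
    let X : Submodule A K := Submodule.span A {x} ⊔ Submodule.map (Algebra.linearMap A K) P
    have hX : ∀ n ∈ N, ∃ k, y ^ k • n ∈ X := by
      rintro n ⟨-, k, a, q, hq, h⟩
      exact ⟨k, h ▸ Submodule.add_mem_sup (Submodule.mem_span_singleton.mpr ⟨a, rfl⟩) ⟨q, hq, rfl⟩⟩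
    have hSN : ∀ n ∈ S, n ∈ N := fun n hn => hS ▸ Submodule.subset_span hn
    choose! κ hκ using hX
    refine ⟨S.sup κ, fun n hn => ?_⟩
    have hle : N ≤ X.comap (LinearMap.lsmul A K (y ^ S.sup κ)) := by
      rw [← hS, Submodule.span_le]
      intro n hn
      obtain ⟨l, hl⟩ := Nat.exists_eq_add_of_le (Finset.le_sup (f := κ) hn)
      change y ^ S.sup κ • n ∈ X
      rw [hl, add_comm, pow_add, mul_smul]
      exact X.smul_mem _ (hκ n (hSN n hn))
    obtain ⟨u, hu, v, ⟨q, hq, rfl⟩, huv⟩ := Submodule.mem_sup.mp (hle hn)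
    obtain ⟨a, rfl⟩ := Submodule.mem_span_singleton.mp hu
    exact ⟨a, q, hq, huv.symm⟩
  refine not_forall_mem_of_ker_le_range_lsmul (N := N ⧸ PN) hQ ?_ ?_ g hg (k := k) ?_
    (PN.liftQ φ hPφ) ?_ ?_
  · intro q hq n
    obtain ⟨n, rfl⟩ := Submodule.Quotient.mk_surjective _ n
    rw [← Submodule.Quotient.mk_smul, Submodule.Quotient.mk_eq_zero, hmemPN]
    exact hNM n n.2 q hq
  · rw [← LinearMap.ker_eq_bot, LinearMap.ker_eq_bot']
    intro n hn
    obtain ⟨n, rfl⟩ := Submodule.Quotient.mk_surjective _ n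
    rw [LinearMap.lsmul_apply, ← Submodule.Quotient.mk_smul, Submodule.Quotient.mk_eq_zero,
      hmemPN] at hn
    obtain ⟨q, hq, h⟩ := hn
    rw [Submodule.Quotient.mk_eq_zero, hmemPN]
    exact exists_mem_of_pow_smul_eq hx hP hy hred (hint n (hNM n n.2)) (k := 1) hq
      (by rw [h, pow_one]; rfl)
  · intro n
    obtain ⟨n, rfl⟩ := Submodule.Quotient.mk_surjective _ n
    obtain ⟨a, q, hq, h⟩ := hk n n.2
    refine ⟨a, ?_⟩
    rw [← Submodule.Quotient.mk_smul]
    refine ((Submodule.Quotient.eq _).mpr (hmemPN.mpr ⟨-q, neg_mem hq, ?_⟩))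
    rw [map_neg, Submodule.coe_sub, Submodule.coe_smul, h, LinearMap.toSpanSingleton_apply,
      Submodule.coe_smul]
    ring
  · intro n hn
    obtain ⟨n, rfl⟩ := Submodule.Quotient.mk_surjective _ n
    have hn' : σ n ∈ P ⊔ Ideal.span {y} := (Submodule.Quotient.mk_eq_zero _).mp hn
    obtain ⟨q, hq, e, he, hqe⟩ := Submodule.mem_sup.mp hn'
    obtain ⟨f, rfl⟩ := Ideal.mem_span_singleton.mp he
    have h1 : (n : K) = algebraMap A K q + y • (algebraMap A K f + w n) := by
      rw [hσ n, ← hqe, map_add, map_mul, smul_add, Algebra.smul_def y (algebraMap A K f), add_assoc]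
    -- Here saturation is needed: y^(k+1)(f + w) = y^k(n - q) is in Ax + P, so the quotient by y
    -- stays in N.
    have h2 : algebraMap A K f + w n ∈ N := by
      refine ⟨add_mem (Subalgebra.algebraMap_mem _ f) (hw n), ?_⟩
      obtain ⟨a, r, hr, h⟩ := hk n n.2
      refine ⟨k + 1, a, r - y ^ k * q, sub_mem hr (P.mul_mem_left _ hq), ?_⟩
      rw [pow_succ, mul_smul, map_sub, map_mul, ← Algebra.smul_def, ← add_sub_assoc, ← h, h1,
        smul_add (y ^ k) (algebraMap A K q), add_sub_cancel_left]
    refine ⟨Submodule.Quotient.mk ⟨_, h2⟩, ?_⟩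
    rw [LinearMap.lsmul_apply, ← Submodule.Quotient.mk_smul]
    refine ((Submodule.Quotient.eq _).mpr (hmemPN.mpr ⟨-q, neg_mem hq, ?_⟩))
    rw [map_neg, Submodule.coe_sub, Submodule.coe_smul, h1]
    ring
  · intro n
    obtain ⟨n, rfl⟩ := Submodule.Quotient.mk_surjective _ n
    refine (Submodule.Quotient.mk_eq_zero _).mpr ?_
    obtain ⟨t, ht, h⟩ := hsq n n.2
    have hnM := hNM n n.2
    -- Expanding σ² = (n - yw)² gives σ² + y(2nw) = n² + y(yw²), so σ² is congruent to n² in P.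
    have h1 := huniq (s := σ n ^ 2) (s' := t) (w := (2 : A) • ((n : K) * w n))
      (w' := y • (w n * w n)) (Subalgebra.smul_mem _ (mul_mem hnM (hw n)) _)
      (Subalgebra.smul_mem _ (mul_mem (hw n) (hw n)) _) (by
        have h2 := hσ n
        simp only [Algebra.smul_def, map_pow, map_ofNat] at h2 ⊢
        rw [h]
        linear_combination (-(n : K) - algebraMap A K (σ n) + algebraMap A K y * w n) * h2)
    refine hQp.mem_of_pow_mem 2 (hQ.1.2 ?_)
    simpa using add_mem h1 (Ideal.mem_sup_left ht)

end Seminormal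

/-! ### Assembly: from relations in A to a fraction with prime denominator ideal -/

theorem IsNormalRing.of_quotient_span_singleton {A : Type u} [CommRing A] [IsNoetherianRing A]
    {y : A} (hyj : y ∈ Ideal.jacobson (⊥ : Ideal A)) (hy : y ∈ A⁰)
    (h : IsNormalRing (A ⧸ Ideal.span {y})) : IsNormalRing A := by
  refine ⟨isReduced_of_isReduced_quotient hyj hy h.1,
    isIntegrallyClosedIn_iff.mpr ⟨IsFractionRing.injective A _, fun {x} hx => ?_⟩⟩
  by_contra hxA
  obtain ⟨a, ha⟩ := exists_isPrime_denominatorIdeal_smul hxA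
  exact denominatorIdeal_not_isPrime_of_isIntegrallyClosedIn hyj hy h.1 h.2 (hx.smul a) ha

theorem IsSeminormalRing.of_quotient_span_singleton {A : Type u} [CommRing A]
    [IsNoetherianRing A] {y : A} (hyj : y ∈ Ideal.jacobson (⊥ : Ideal A)) (hy : y ∈ A⁰)
    (h : IsSeminormalRing (A ⧸ Ideal.span {y})) : IsSeminormalRing A := by
  have hred := isReduced_of_isReduced_quotient hyj hy h.isReduced
  intro b c hbc
  have hinj := IsFractionRing.injective A (FractionRing A)
  obtain ⟨b', hb', hd⟩ := exists_mul_eq_zero_add_mem_nonZeroDivisors b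
  have hcb : c * b' = 0 := by
    refine eq_zero_of_pow_eq_zero (n := 2) ?_
    linear_combination b ^ 2 * b' * hb' - b' ^ 2 * hbc
  let ι := algebraMap A (FractionRing A)
  -- The candidate root is x = c/(b + b'). Because bb' = cb' = 0, it satisfies x² = b and x³ = c.
  obtain ⟨v, hv⟩ := (IsLocalization.map_units (FractionRing A) (⟨_, hd⟩ : A⁰)).exists_right_inv
  have hv' : ι (b + b') * v = 1 := hv
  have hx2 : ι b = (ι c * v) ^ 2 := by
    have h1 : ι c ^ 2 = ι b * ι (b + b') ^ 2 := by
      rw [← map_pow, ← map_pow, ← map_mul]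
      congr 1
      linear_combination (-2 * b - b') * hb' - hbc
    rw [mul_pow, h1]
    linear_combination (-ι b * (ι (b + b') * v + 1)) * hv'
  have hx3 : ι c = (ι c * v) ^ 3 := by
    have h1 : ι c * ι (b + b') = ι c * ι b := by
      rw [map_add]
      have : ι c * ι b' = 0 := by rw [← map_mul, hcb, map_zero]
      linear_combination this
    rw [pow_succ, ← hx2]
    linear_combination (-ι c) * hv' + v * h1
  by_cases hxA : ι c * v ∈ Set.range ι
  · obtain ⟨a, ha⟩ := hxA
    exact ⟨a, hinj (by rw [map_pow]; exact ha ▸ hx2.symm),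
      hinj (by rw [map_pow]; exact ha ▸ hx3.symm)⟩
  · obtain ⟨a, ha⟩ := exists_isPrime_denominatorIdeal_smul hxA
    refine absurd ha (denominatorIdeal_not_isPrime_of_isSeminormalRing hyj hy h
      (b := a ^ 2 * b) (c := a ^ 3 * c) ?_ ?_)
    · rw [map_mul, map_pow, Algebra.smul_def, mul_pow, ← hx2]
    · rw [map_mul, map_pow, Algebra.smul_def, mul_pow, ← hx3]

theorem IsWeaklyNormalRing.of_quotient_span_singleton {A : Type u} [CommRing A]
    [IsNoetherianRing A] {y : A} (hyj : y ∈ Ideal.jacobson (⊥ : Ideal A)) (hy : y ∈ A⁰)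
    (h : IsWeaklyNormalRing (A ⧸ Ideal.span {y})) : IsWeaklyNormalRing A := by
  refine ⟨h.1.of_quotient_span_singleton hyj hy, fun b c e d hd p hp hcp hce => ?_⟩
  have hinj := IsFractionRing.injective A (FractionRing A)
  let ι := algebraMap A (FractionRing A)
  obtain ⟨v, hv⟩ := (IsLocalization.map_units (FractionRing A) (⟨d, hd⟩ : A⁰)).exists_right_inv
  have hv' : ι d * v = 1 := hv
  have hxp : ι b = (ι c * v) ^ p := by
    rw [mul_pow, ← map_pow, hcp, map_mul, map_pow, mul_assoc, ← mul_pow, hv', one_pow, mul_one]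
  have hxe : ι e = p * (ι c * v) := by
    have h1 : (p : FractionRing A) * ι c = ι d * ι e := by
      rw [← map_natCast ι, ← map_mul, hce, map_mul]
    linear_combination (-ι e) * hv' - v * h1
  by_cases hxA : ι c * v ∈ Set.range ι
  · obtain ⟨a, ha⟩ := hxA
    exact ⟨a, hinj (by rw [map_pow]; exact ha ▸ hxp),
      hinj (by rw [map_mul, map_natCast]; exact ha ▸ hxe)⟩
  · obtain ⟨a, ha⟩ := exists_isPrime_denominatorIdeal_smul hxA
    refine absurd ha (denominatorIdeal_not_isPrime_of_pow_prime hyj hy h hp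
      (b := a ^ p * b) (e := a * e) ?_ ?_)
    · rw [map_mul, map_pow, Algebra.smul_def, mul_pow, ← hxp]
    · rw [map_mul, Algebra.smul_def, mul_left_comm, ← hxe]

theorem theoremC {A : Type u} [CommRing A] [IsNoetherianRing A] [IsLocalRing A]
    (y : A) (hym : y ∈ IsLocalRing.maximalIdeal A) (hy : y ∈ nonZeroDivisors A) :
    (IsNormalRing (A ⧸ Ideal.span {y}) → IsNormalRing A) ∧
      (IsWeaklyNormalRing (A ⧸ Ideal.span {y}) → IsWeaklyNormalRing A) := by
  have hyj : y ∈ Ideal.jacobson (⊥ : Ideal A) := by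
    rwa [IsLocalRing.jacobson_eq_maximalIdeal _ bot_ne_top]
  exact ⟨fun h => h.of_quotient_span_singleton hyj hy,
    fun h => h.of_quotient_span_singleton hyj hy⟩
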